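/- Let $\mathcal H$ be a complex Hilbert space with inner product $\langle\cdot,\cdot\rangle$ linear in the first argument, let $(\psi_n)_{n\in\mathbb Z}$ be unit vectors in $\mathcal H$ whose Gram matrix $G=(\langle\psi_n,\psi_m\rangle)_{n,m\in\mathbb Z}$ is bounded on $\ell^2(\mathbb Z)$ and satisfies $\langle\psi_{n+1},\psi_{m+1}\rangle=\langle\psi_n,\psi_m\rangle$ for all $n,m$. Let $\mathbf P_0$ be a probability measure on $\mathbb R$ whose support is a compact subset of $(0,\infty)$, and let $\varkappa=(\varkappa_n)_{n\in\mathbb Z}$ be i.i.d. with distribution $\mathbf P_0$, i.e. distributed according to $\mathbf P=\prod_{n\in\mathbb Z}\mathbf P_0$ on $\mathbb R^{\mathbb Z}$. Put $$\mathcal P_\varkappa=\sum_{n\in\mathbb Z}\varkappa_n\langle\cdot,\psi_n\rangle\psi_n=\operatorname*{s-lim}_{N\to\infty}\sum_{n=-N}^{N}\varkappa_n\langle\cdot,\psi_n\rangle\psi_n ,\qquad \varphi(k)=\sum_{n\in\mathbb Z}\langle\psi_n,\psi_0\rangle e^{ink}\ \text{ in } L^2(\mathbb T).$$ The function $\varphi$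 is real-valued a.e. Let $\operatorname{essran}\varphi=\{a\in\mathbb R:\operatorname{meas}\{k:|\varphi(k)-a|<\varepsilon\}>0\ \ \forall\varepsilon>0\}$, $\varphi_{\min}=\inf\operatorname{essran}\varphi$, $\varphi_{\max}=\sup\operatorname{essran}\varphi$, $\varkappa_{\min}=\inf\operatorname{supp}\mathbf P_0$, $\varkappa_{\max}=\sup\operatorname{supp}\mathbf P_0$. Write $X\cdot Y=\{xy:x\in X,\ y\in Y\}$ and let $\operatorname{conv}$ denote the closed convex hull. **Theorem.** There is a set $\Sigma\subset\mathbb R$ (the deterministic spectrum) such that, almost surely, the strong limit $\mathcal P_\varkappa$ exists as a bounded operator and $\sigma(\mathcal P_\varkappa)=\Sigma$. It satisfies $$(\operatorname{supp}\mathbf P_0\cdot\operatorname{essran}\varphi)\setminus\{0\}\subset\Sigma,\qquad \Sigma\setminus\{0\}\subset\operatorname{supp}\mathbf P_0\cdot\operatorname{conv}(\operatorname{essran}\varphi),\qquad \max\Sigma=\varkappa_{\max}\varphi_{\max}.$$ Suppose moreover that the following compatibility condition at the point $0$ holds: if the closed linear span of $\{\psi_n\}$ is not $\mathcal H$, then $0\in\operatorname{essran}\varphi$;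 and if it is $\mathcal H$, then $0$ is not an isolated point of $\operatorname{essran}\varphi$. (This always holds for the standard realisation $\psi_n=L_{\sqrt\varphi}\,\delta_n$ in $\mathcal H=\ell^2(\mathbb Z)$, where $(\delta_n)$ is the canonical basis and $L_\theta$ is the Laurent operator, i.e. convolution with the Fourier coefficients of $\theta$.) Then: (i) $\operatorname{supp}\mathbf P_0\cdot\operatorname{essran}\varphi\subset\Sigma\subset\operatorname{supp}\mathbf P_0\cdot\operatorname{conv}(\operatorname{essran}\varphi)$. (ii) $\Sigma\subset[\varkappa_{\min}\varphi_{\min},\varkappa_{\max}\varphi_{\max}]$, $\ \min\Sigma=\varkappa_{\min}\varphi_{\min}$ and $\max\Sigma=\varkappa_{\max}\varphi_{\max}$. In particular, if $\operatorname{essran}\varphi$ is an interval (possibly a single point), then $\Sigma=\operatorname{supp}\mathbf P_0\cdot\operatorname{essran}\varphi$. -/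

import Mathlib

open MeasureTheory Filter Topology Set
open scoped Pointwise

noncomputable section

namespace RandomProjections

/-- The period `2π` is positive, so that Fourier analysis on `AddCircle (2π)` is available. -/
instance two_pi_pos_fact : Fact (0 < 2 * Real.pi) := ⟨Real.two_pi_pos⟩

/-- The unit circle `ℝ / 2πℤ`. -/
abbrev Circ : Type := AddCircle (2 * Real.pi)

/-- Lebesgue measure on the circle, normalised to total mass one. -/
abbrev circMeas : Measure Circ := AddCircle.haarAddCircle

/-- The Hilbert space `ℓ²(ℤ)`. -/
abbrev EllTwo : Type := lp (fun _ : ℤ => ℂ) 2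

/-- The doubly infinite matrix `M` is (the matrix of) a bounded operator on `ℓ²(ℤ)`: there is a
bounded `T` whose value on the `m`-th canonical basis vector is the `m`-th column of `M`. -/
def IsBoundedMatrix (M : ℤ → ℤ → ℂ) : Prop :=
  ∃ T : EllTwo →L[ℂ] EllTwo, ∀ n m : ℤ, T (lp.single 2 m (1 : ℂ)) n = M n m

/-- Essential range of a real function on the circle. -/
def essRan (f : Circ → ℝ) : Set ℝ :=
  {a | ∀ ε > 0, 0 < circMeas {x | |f x - a| < ε}}

variable {H : Type*} [NormedAddCommGroup H] [InnerProductSpace ℂ H]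

/-- The Gram matrix `⟨ψ n, ψ m⟩`, for the inner product that is linear in the *first* argument
(Mathlib's `inner` is linear in the second one). -/
def gramMatrix (ψ : ℤ → H) (n m : ℤ) : ℂ := inner ℂ (ψ m) (ψ n)

/-- The Fourier series `∑ₙ ⟨ψ n, ψ 0⟩ e^{ink}`, as an `L²`-convergent sum. -/
def symbolLp (ψ : ℤ → H) : Lp ℂ 2 circMeas :=
  ∑' n : ℤ, gramMatrix ψ n 0 • fourierLp (T := 2 * Real.pi) 2 n

/-- The symbol, as a real function. (For a shift-invariant Gram matrix the coefficients satisfy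
`c (-n) = conj (c n)`, so that the Fourier series is real almost everywhere.) -/
def symbol (ψ : ℤ → H) : Circ → ℝ := fun x => (symbolLp ψ x).re

/-- The finite sum `∑_{n=-N}^{N} κ n ⟨·, ψ n⟩ ψ n`. -/
def partialOp (ψ : ℤ → H) (κ : ℤ → ℝ) (N : ℕ) : H →L[ℂ] H :=
  ∑ n ∈ Finset.Icc (-(N : ℤ)) (N : ℤ), (κ n : ℂ) • InnerProductSpace.rankOne ℂ (ψ n) (ψ n)

/-- The bounded operator `P` is the sum `∑_{n ∈ ℤ} κ n ⟨·, ψ n⟩ ψ n`, i.e. the strong limit of the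
finite sums. -/
def IsRandomSum (ψ : ℤ → H) (κ : ℤ → ℝ) (P : H →L[ℂ] H) : Prop :=
  ∀ x : H, Tendsto (fun N : ℕ => partialOp ψ κ N x) atTop (𝓝 (P x))

/-- The set `S` of reals is the deterministic spectrum of `∑ₙ κ n ⟨·, ψ n⟩ ψ n`, where the `κ n`
are independent with distribution `P₀`: almost surely the series converges strongly to a bounded
operator whose (complex) spectrum is `S`. -/
def IsDeterministicSpectrum (ψ : ℤ → H) (P₀ : Measure ℝ) [IsProbabilityMeasure P₀]
    (S : Set ℝ) : Prop :=
  ∀ᵐ κ ∂(Measure.infinitePi (fun _ : ℤ => P₀)),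
    ∃ P : H →L[ℂ] H, IsRandomSum ψ κ P ∧ spectrum ℂ P = (fun t : ℝ => (t : ℂ)) '' S

/-- The sequence `ψ` is complete: its closed linear span is the whole space. -/
def IsCompleteSeq (ψ : ℤ → H) : Prop :=
  (Submodule.span ℂ (range ψ)).topologicalClosure = ⊤

/-- Compatibility of the space `H` with the symbol at the point `0`. A vector orthogonal to all
`ψ n` puts `0` into the spectrum, so if there is one, `0` has to lie in the essential range; and if
there is none, then `0` must not be an isolated point of the essential range. Both hold for
`ψ n = L δ_n` in `ℓ²(ℤ)`, where `L` is the Laurent operator with symbol `√φ`, and whenever `ψ` is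
complete and `φ` is nonzero almost everywhere. -/
def ZeroCompatible (ψ : ℤ → H) : Prop :=
  (¬ IsCompleteSeq ψ → (0 : ℝ) ∈ essRan (symbol ψ)) ∧
  (IsCompleteSeq ψ → (0 : ℝ) ∈ essRan (symbol ψ) → AccPt (0 : ℝ) (𝓟 (essRan (symbol ψ))))

end RandomProjections

end

/-!
With the analysis operator `B x = (⟨x, ψ n⟩)ₙ` and the diagonal operator `D_κ` on `ℓ²(ℤ)`, the
random operator is `B* D_κ B`. Since `1 - XY` and `1 - YX` are invertible together, a real `t ≠ 0`
lies in its spectrum iff `B B* - D_{t/κ}` is not invertible, and the Gram operator `B B*` is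
unitarily equivalent to multiplication by the symbol. Being self-adjoint, `B B* - D_{t/κ}` is
invertible iff it is bounded below, a property that survives translations and pointwise limits of
`κ`. Almost surely the translates of `κ` are dense in the product of the supports, so the spectrum
is the union of the spectra over *all* sequences with values in the support. Constant sequences
give the lower inclusion. For the upper one, if every `t / κ n` has distance at least `δ` from
`conv (essran φ) = [m, M]`, then `D_{t/κ}` differs from the midpoint `(m + M) / 2` by at least
`(M - m) / 2 + δ` in each entry, while `B B*` differs from it by at most `(M - m) / 2` in norm.
-/

noncomputable section

namespace RandomProjections

open scoped InnerProductSpace lp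

section BoundedBelow

variable {𝕜 E F : Type*} [NontriviallyNormedField 𝕜] [NormedAddCommGroup E] [NormedSpace 𝕜 E]
  [NormedAddCommGroup F] [NormedSpace 𝕜 F]

theorem exists_mul_norm_le_of_isUnit_comp {A : F →L[𝕜] E} {B : E →L[𝕜] F}
    (h : IsUnit (A ∘L B)) : ∃ c > 0, ∀ x, c * ‖x‖ ≤ ‖B x‖ := by
  obtain ⟨u, hu⟩ := h
  set L : F →L[𝕜] E := (↑u⁻¹ : E →L[𝕜] E) ∘L A
  have hL (x : E) : L (B x) = x := by
    have : (↑u⁻¹ * (A ∘L B)) x = x := by rw [← hu, u.inv_mul]; rfl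
    exact this
  refine ⟨(‖L‖ + 1)⁻¹, by positivity, fun x => ?_⟩
  rw [inv_mul_le_iff₀ (by positivity)]
  calc ‖x‖ = ‖L (B x)‖ := by rw [hL]
    _ ≤ ‖L‖ * ‖B x‖ := L.le_opNorm _
    _ ≤ (‖L‖ + 1) * ‖B x‖ := by gcongr; linarith

theorem exists_mul_norm_le_of_isUnit {T : E →L[𝕜] E} (h : IsUnit T) :
    ∃ c > 0, ∀ x, c * ‖x‖ ≤ ‖T x‖ :=
  exists_mul_norm_le_of_isUnit_comp (A := ContinuousLinearMap.id 𝕜 E) h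

theorem exists_mul_norm_le_comp_iff {A : E →L[𝕜] F} {S : F →L[𝕜] F} (hS : IsUnit S) :
    (∃ c > 0, ∀ x, c * ‖x‖ ≤ ‖(S ∘L A) x‖) ↔ ∃ c > 0, ∀ x, c * ‖x‖ ≤ ‖A x‖ := by
  constructor
  · rintro ⟨c, hc, hcx⟩
    refine ⟨c / (‖S‖ + 1), by positivity, fun x => ?_⟩
    rw [div_mul_eq_mul_div, div_le_iff₀ (by positivity)]
    calc c * ‖x‖ ≤ ‖S (A x)‖ := hcx x
      _ ≤ ‖S‖ * ‖A x‖ := S.le_opNorm _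
      _ ≤ ‖A x‖ * (‖S‖ + 1) := by linarith [norm_nonneg (A x)]
  · rintro ⟨c, hc, hcx⟩
    obtain ⟨d, hd, hdx⟩ := exists_mul_norm_le_of_isUnit hS
    refine ⟨d * c, mul_pos hd hc, fun x => ?_⟩
    calc d * c * ‖x‖ = d * (c * ‖x‖) := mul_assoc _ _ _
      _ ≤ d * ‖A x‖ := by gcongr; exact hcx x
      _ ≤ ‖(S ∘L A) x‖ := hdx (A x)

theorem isUnit_one_sub_comp_of_swap {A : F →L[𝕜] E} {B : E →L[𝕜] F}
    (h : IsUnit (1 - B ∘L A)) : IsUnit (1 - A ∘L B) := by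
  obtain ⟨u, hu⟩ := h
  set S : F →L[𝕜] F := ↑u⁻¹
  have hSl (y : F) : S y - S (B (A y)) = y := by
    have : (S * (1 - B ∘L A)) y = y := by rw [← hu, u.inv_mul]; rfl
    simpa using this
  have hSr (y : F) : S y - B (A (S y)) = y := by
    have : ((1 - B ∘L A) * S) y = y := by rw [← hu, u.mul_inv]; rfl
    simpa using this
  refine isUnit_iff_exists.mpr ⟨1 + A ∘L S ∘L B, ?_, ?_⟩ <;> ext x
  · have := congrArg A (hSr (B x))
    simp only [map_sub] at this
    simp [← this]
  · have := congrArg A (hSl (B x))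
    simp only [map_sub] at this
    simp only [ContinuousLinearMap.mul_def, ContinuousLinearMap.comp_apply, add_apply, sub_apply,
      one_apply_eq_self, map_sub]
    rw [eq_add_of_sub_eq this]
    abel

theorem isUnit_one_sub_comp_comm {A : F →L[𝕜] E} {B : E →L[𝕜] F} :
    IsUnit (1 - A ∘L B) ↔ IsUnit (1 - B ∘L A) :=
  ⟨isUnit_one_sub_comp_of_swap, isUnit_one_sub_comp_of_swap⟩

end BoundedBelow

section SelfAdjoint

open ContinuousLinearMap

variable {𝕜 E F : Type*} [RCLike 𝕜] [NormedAddCommGroup E] [InnerProductSpace 𝕜 E]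
  [CompleteSpace E] [NormedAddCommGroup F] [InnerProductSpace 𝕜 F]

theorem isUnit_of_isSelfAdjoint_of_mul_norm_le {T : E →L[𝕜] E}
    (hT : IsSelfAdjoint T) {c : ℝ} (hc : 0 < c) (h : ∀ x, c * ‖x‖ ≤ ‖T x‖) : IsUnit T := by
  have hanti : AntilipschitzWith c.toNNReal⁻¹ T := T.antilipschitz_of_bound fun x => by
    rw [NNReal.coe_inv, Real.coe_toNNReal _ hc.le, ← div_eq_inv_mul, le_div_iff₀' hc]
    exact h x
  rw [ContinuousLinearMap.isUnit_iff_bijective,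
    ContinuousLinearMap.bijective_iff_dense_range_and_antilipschitz,
    Submodule.topologicalClosure_eq_top_iff, T.orthogonal_range, hT.adjoint_eq]
  exact ⟨LinearMap.ker_eq_bot.mpr hanti.injective, _, hanti⟩

theorem isUnit_of_isSelfAdjoint_of_surjective {T : E →L[𝕜] E}
    (hT : IsSelfAdjoint T) (h : Function.Surjective T) : IsUnit T := by
  have hker : T.ker = ⊥ := by
    rw [← hT.adjoint_eq, ← T.orthogonal_range, LinearMap.range_eq_top.mpr h,
      Submodule.top_orthogonal_eq_bot]
  exact ContinuousLinearMap.isUnit_iff_bijective.mpr ⟨LinearMap.ker_eq_bot.mp hker, h⟩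

theorem isUnit_adjoint_comp_self_iff [CompleteSpace F] {A : E →L[𝕜] F} :
    IsUnit (adjoint A ∘L A) ↔ ∃ c > 0, ∀ x, c * ‖x‖ ≤ ‖A x‖ := by
  refine ⟨exists_mul_norm_le_of_isUnit_comp, fun ⟨c, hc, h⟩ => ?_⟩
  refine isUnit_of_forall_le_norm_inner_map _ (c := (c ^ 2).toNNReal) (by positivity) fun x => ?_
  rw [comp_apply, adjoint_inner_left, inner_self_eq_norm_sq_to_K,
    Real.coe_toNNReal _ (by positivity), norm_pow, RCLike.norm_ofReal, abs_norm, mul_comm,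
    ← mul_pow]
  exact pow_le_pow_left₀ (by positivity) (h x) 2

theorem norm_sub_algebraMap_midpoint_le {A : Type*} [CStarAlgebra A] {a : A}
    (ha : IsSelfAdjoint a) {m M : ℝ} (hmM : m ≤ M) (hspec : spectrum ℝ a ⊆ Icc m M) :
    ‖a - algebraMap ℝ A (midpoint ℝ m M)‖ ≤ (M - m) / 2 := by
  have hcfc : cfc (fun y : ℝ => y - midpoint ℝ m M) a = a - algebraMap ℝ A (midpoint ℝ m M) := by
    rw [cfc_sub .., cfc_id' ℝ a, cfc_const _ a]
  rw [← hcfc]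
  refine norm_cfc_le (by linarith) fun y hy => ?_
  obtain ⟨h1, h2⟩ := hspec hy
  rw [Real.norm_eq_abs, midpoint_eq_smul_add, smul_eq_mul, invOf_eq_inv, abs_le]
  constructor <;> linarith

end SelfAdjoint

section TypicalSequences

open ProbabilityTheory

theorem iIndepSet_iInter_prod {Ω ι κ : Type*} [MeasurableSpace Ω] {μ : Measure Ω} [Finite κ]
    {A : ι × κ → Set Ω} (hA : ∀ p, MeasurableSet (A p)) (h : iIndepSet A μ) :
    iIndepSet (fun i => ⋂ k, A (i, k)) μ := by
  have := Fintype.ofFinite κ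
  have hprod (t : Finset ι) : μ (⋂ i ∈ t, ⋂ k, A (i, k)) = ∏ i ∈ t, ∏ k, μ (A (i, k)) := by
    rw [← Finset.prod_product', ← (iIndepSet_iff_meas_biInter hA).mp h]
    congr 1 with ω
    simp only [mem_iInter, Finset.mem_product, Finset.mem_univ, and_true, Prod.forall]
    tauto
  rw [iIndepSet_iff_meas_biInter fun i => MeasurableSet.iInter fun k => hA (i, k)]
  intro t
  rw [hprod]
  exact Finset.prod_congr rfl fun i _ => by simpa using (hprod {i}).symm

theorem iIndepSet_preimage_of_iIndepFun {Ω ι : Type*} {α : ι → Type*} [MeasurableSpace Ω]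
    [∀ i, MeasurableSpace (α i)] {μ : Measure Ω} {X : ∀ i, Ω → α i} (hX : ∀ i, Measurable (X i))
    (h : iIndepFun X μ) {b : ∀ i, Set (α i)} (hb : ∀ i, MeasurableSet (b i)) :
    iIndepSet (fun i => X i ⁻¹' b i) μ := by
  rw [iIndepSet_iff_meas_biInter fun i => hX i (hb i)]
  exact fun t => h.measure_inter_preimage_eq_mul t fun i _ => hb i

theorem injective_add_mul_of_two_mul_abs_lt {F : Finset ℤ} {L : ℤ}
    (hL : ∀ n ∈ F, 2 * |n| < L) : Function.Injective fun p : ℕ × F => (p.2 : ℤ) + p.1 * L := by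
  rintro ⟨i, n, hn⟩ ⟨i', n', hn'⟩ h
  have h1 := abs_lt.mp (show |n - n'| < L by
    have := abs_sub n n'; linarith [hL n hn, hL n' hn'])
  simp only at h
  have hi : (i : ℤ) = i' := by
    rcases lt_trichotomy (i : ℤ) i' with h2 | h2 | h2
    · nlinarith
    · exact h2
    · nlinarith
  simp_all

variable {α : Type*} [MeasurableSpace α] (P₀ : Measure α) [IsProbabilityMeasure P₀]

theorem ae_exists_forall_mem_shift (F : Finset ℤ) {b : F → Set α} (hb : ∀ n, MeasurableSet (b n))
    (hpos : ∀ n, P₀ (b n) ≠ 0) :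
    ∀ᵐ κ ∂(Measure.infinitePi fun _ : ℤ => P₀), ∃ j : ℤ, ∀ n : F, κ (n + j) ∈ b n := by
  set μ := Measure.infinitePi fun _ : ℤ => P₀
  obtain ⟨L, hL⟩ : ∃ L : ℤ, ∀ n ∈ F, 2 * |n| < L :=
    ⟨_, fun n hn => Int.lt_add_one_of_le (Finset.single_le_sum
      (f := fun n => 2 * |n|) (fun n _ => by positivity) hn)⟩
  let A (p : ℕ × F) : Set (ℤ → α) := (fun κ => κ (p.2 + p.1 * L)) ⁻¹' b p.2
  have hA : ∀ p, MeasurableSet (A p) := fun p => measurable_pi_apply _ (hb _)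
  have hcoord : iIndepFun (fun (n : ℤ) (κ : ℤ → α) => κ n) μ :=
    iIndepFun_infinitePi (P := fun _ : ℤ => P₀) (X := fun _ ω => ω) fun _ => measurable_id
  have hindep : iIndepSet A μ :=
    iIndepSet_preimage_of_iIndepFun (fun _ => measurable_pi_apply _)
      (hcoord.precomp (injective_add_mul_of_two_mul_abs_lt hL)) fun p => hb p.2
  have hmeas (i : ℕ) : MeasurableSet (⋂ n, A (i, n)) := .iInter fun n => hA (i, n)
  have hblock (i : ℕ) : μ (⋂ n, A (i, n)) = ∏ n : F, P₀ (b n) := by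
    have hcol : iIndepSet (fun n => A (i, n)) μ :=
      iIndepSet.precomp (s := A) (Prod.mk_right_injective i) hindep
    have hprod := (iIndepSet_iff_meas_biInter fun n => hA (i, n)).mp hcol Finset.univ
    simp only [Finset.mem_univ, iInter_true] at hprod
    rw [hprod]
    exact Finset.prod_congr rfl fun n _ =>
      (measurePreserving_eval_infinitePi (fun _ : ℤ => P₀) (n + i * L)).measure_preimage
        (hb n).nullMeasurableSet
  have hlimsup := measure_limsup_eq_one hmeas (iIndepSet_iInter_prod hA hindep) (by
    simp_rw [hblock]
    exact ENNReal.tsum_const_eq_top_of_ne_zero (Finset.prod_ne_zero_iff.mpr fun n _ => hpos n))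
  rw [← mem_ae_iff_prob_eq_one (MeasurableSet.measurableSet_limsup hmeas)] at hlimsup
  filter_upwards [hlimsup] with κ hκ
  obtain ⟨i, hi⟩ := (mem_limsup_iff_frequently_mem.mp hκ).exists
  exact ⟨i * L, mem_iInter.mp hi⟩

/-- A sequence `κ` with values in `K` is typical if its translates are dense in `K^ℤ` for the
product topology. Almost every sample of independent variables whose common law has support `K` is
typical, and this is the only property of a sample that the spectrum depends on. -/
def IsTypical {α : Type*} [TopologicalSpace α] (K : Set α) (κ : ℤ → α) : Prop :=
  (∀ n, κ n ∈ K) ∧ univ.pi (fun _ => K) ⊆ closure (range fun (j : ℤ) (n : ℤ) => κ (n + j))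

theorem ae_isTypical [TopologicalSpace α] [SecondCountableTopology α] [OpensMeasurableSpace α] :
    ∀ᵐ κ ∂(Measure.infinitePi fun _ : ℤ => P₀), IsTypical P₀.support κ := by
  have hsupp : ∀ᵐ κ ∂(Measure.infinitePi fun _ : ℤ => P₀), ∀ n, κ n ∈ P₀.support :=
    ae_all_iff.mpr fun n =>
      (measurePreserving_eval_infinitePi (fun _ : ℤ => P₀) n).quasiMeasurePreserving.ae
        Measure.support_mem_ae
  have hbasis := TopologicalSpace.isBasis_countableBasis α
  have hvisit : ∀ᵐ κ ∂(Measure.infinitePi fun _ : ℤ => P₀),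
      ∀ (F : Finset ℤ) (u : F → TopologicalSpace.countableBasis α),
        (∀ n, P₀ (u n : Set α) ≠ 0) → ∃ j : ℤ, ∀ n : F, κ (n + j) ∈ (u n : Set α) := by
    refine ae_all_iff.mpr fun F => ae_all_iff.mpr fun u => eventually_imp_distrib_left.mpr fun hu =>
      ae_exists_forall_mem_shift P₀ F (fun n => (hbasis.isOpen (u n).2).measurableSet) hu
  filter_upwards [hsupp, hvisit] with κ hκ hshift
  refine ⟨hκ, fun κ' hκ' => mem_closure_iff.mpr fun o ho hκ'o => ?_⟩
  obtain ⟨F, v, hv, hvo⟩ := isOpen_pi_iff.mp ho κ' hκ'o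
  choose u hu hκ'u huv using fun n : F =>
    hbasis.exists_subset_of_mem_open (hv n n.2).2 (hv n n.2).1
  obtain ⟨j, hj⟩ := hshift F (fun n => ⟨u n, hu n⟩) fun n =>
    (Measure.mem_support_iff_forall _).mp (hκ' n trivial) _
      ((hbasis.isOpen (hu n)).mem_nhds (hκ'u n)) |>.ne'
  exact ⟨_, hvo fun n hn => huv ⟨n, hn⟩ (hj ⟨n, hn⟩), j, rfl⟩

end TypicalSequences

section DiagonalOperators

open Bornology

variable {ι : Type*} {w v : ι → ℝ}

theorem isBounded_range_const (c : ℝ) : IsBounded (range fun _ : ι => c) :=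
  isBounded_singleton.subset range_const_subset

theorem isBounded_range_sub (hw : IsBounded (range w)) (hv : IsBounded (range v)) :
    IsBounded (range fun n => w n - v n) :=
  (hw.sub hv).subset (range_subset_iff.mpr fun n =>
    sub_mem_sub (mem_range_self n) (mem_range_self n))

theorem hasSum_norm_sq (x : ℓ²(ι, ℂ)) : HasSum (fun n => ‖x n‖ ^ 2) (‖x‖ ^ 2) := by
  simpa using lp.hasSum_norm (p := 2) (by norm_num) x

open Classical in
/-- The diagonal operator `x ↦ (w n * x n)` on `ℓ²(ι)`, for bounded real weights `w`. If `w` is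
unbounded there is no such bounded operator, and `diagOp w` is `0`. -/
def diagOp (w : ι → ℝ) : ℓ²(ι, ℂ) →L[ℂ] ℓ²(ι, ℂ) :=
  if h : ∃ C, 0 ≤ C ∧ ∀ n, ‖(w n : ℂ) • ContinuousLinearMap.id ℂ ℂ‖ ≤ C then
    lp.mapCLM 2 (fun n => (w n : ℂ) • ContinuousLinearMap.id ℂ ℂ) h.choose_spec.1 h.choose_spec.2
  else 0

theorem diagOp_apply (hw : IsBounded (range w)) (x : ℓ²(ι, ℂ)) (n : ι) :
    diagOp w x n = w n * x n := by
  obtain ⟨C, hC⟩ := isBounded_iff_forall_norm_le.mp hw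
  have h : ∃ C, 0 ≤ C ∧ ∀ n, ‖(w n : ℂ) • ContinuousLinearMap.id ℂ ℂ‖ ≤ C :=
    ⟨|C|, abs_nonneg C, fun n => by
      simpa [norm_smul] using (hC _ (mem_range_self n)).trans (le_abs_self C)⟩
  simp [diagOp, dif_pos h]

theorem diagOp_const (c : ℝ) :
    diagOp (fun _ : ι => c) = algebraMap ℝ (ℓ²(ι, ℂ) →L[ℂ] ℓ²(ι, ℂ)) c := by
  ext x n
  rw [diagOp_apply (isBounded_range_const c)]
  simp [Algebra.algebraMap_eq_smul_one]

theorem diagOp_sub (hw : IsBounded (range w)) (hv : IsBounded (range v)) :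
    diagOp (fun n => w n - v n) = diagOp w - diagOp v := by
  ext x n
  simp [diagOp_apply, hw, hv, isBounded_range_sub hw hv, sub_mul]

theorem diagOp_mul_diagOp (hw : IsBounded (range w)) (hv : IsBounded (range v))
    (hwv : IsBounded (range fun n => w n * v n)) :
    diagOp w * diagOp v = diagOp fun n => w n * v n := by
  ext x n
  simp [diagOp_apply, hw, hv, hwv, mul_assoc]

theorem diagOp_mul_diagOp_eq_one (hw : IsBounded (range w)) (hv : IsBounded (range v))
    (hwv : ∀ n, w n * v n = 1) : diagOp w * diagOp v = 1 := by
  ext x n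
  simp only [mul_apply_eq_comp, one_apply_eq_self, diagOp_apply hw, diagOp_apply hv,
    ← mul_assoc, ← Complex.ofReal_mul, hwv, Complex.ofReal_one, one_mul]

theorem isUnit_diagOp (hw : IsBounded (range w)) (hw' : IsBounded (range fun n => (w n)⁻¹))
    (h0 : ∀ n, w n ≠ 0) : IsUnit (diagOp w) :=
  isUnit_iff_exists.mpr ⟨diagOp fun n => (w n)⁻¹,
    diagOp_mul_diagOp_eq_one hw hw' fun n => mul_inv_cancel₀ (h0 n),
    diagOp_mul_diagOp_eq_one hw' hw fun n => inv_mul_cancel₀ (h0 n)⟩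

theorem isSelfAdjoint_diagOp (w : ι → ℝ) : IsSelfAdjoint (diagOp w) := by
  unfold diagOp
  split_ifs
  · refine ContinuousLinearMap.isSelfAdjoint_iff_isSymmetric.mpr fun x y => ?_
    simp only [ContinuousLinearMap.coe_coe, lp.inner_eq_tsum]
    refine tsum_congr fun n => ?_
    simp only [lp.mapCLM_apply_coe, smul_apply, ContinuousLinearMap.id_apply, smul_eq_mul,
      RCLike.inner_apply, map_mul, Complex.conj_ofReal]
    ring
  · exact .zero _

theorem mul_norm_le_norm_diagOp_apply (hw : IsBounded (range w)) {c : ℝ} (hc : 0 ≤ c)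
    (h : ∀ n, c ≤ |w n|) (x : ℓ²(ι, ℂ)) : c * ‖x‖ ≤ ‖diagOp w x‖ := by
  rw [← Real.norm_of_nonneg hc, ← norm_smul]
  refine lp.norm_mono two_ne_zero fun n => ?_
  rw [diagOp_apply hw, lp.coeFn_smul, Pi.smul_apply, norm_smul, norm_mul, Real.norm_of_nonneg hc,
    Complex.norm_real]
  exact mul_le_mul_of_nonneg_right (h n) (norm_nonneg _)

theorem isUnit_sub_diagOp_of_gap {T : ℓ²(ι, ℂ) →L[ℂ] ℓ²(ι, ℂ)} (hT : IsSelfAdjoint T)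
    (hw : IsBounded (range w)) {c r ρ : ℝ} (hr : ‖T - algebraMap ℝ _ c‖ ≤ r)
    (hrρ : r < ρ) (hρ : ∀ n, ρ ≤ |w n - c|) : IsUnit (T - diagOp w) := by
  refine isUnit_of_isSelfAdjoint_of_mul_norm_le (hT.sub (isSelfAdjoint_diagOp w))
    (sub_pos.mpr hrρ) fun x => ?_
  have hlow : ρ * ‖x‖ ≤ ‖(diagOp w - algebraMap ℝ _ c) x‖ := by
    rw [← diagOp_const, ← diagOp_sub hw (isBounded_range_const c)]
    exact mul_norm_le_norm_diagOp_apply (isBounded_range_sub hw (isBounded_range_const c))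
      ((norm_nonneg _).trans (hr.trans hrρ.le)) hρ x
  have hup : ‖(T - algebraMap ℝ _ c) x‖ ≤ r * ‖x‖ := ContinuousLinearMap.le_of_opNorm_le _ hr x
  have hdiff : (diagOp w - algebraMap ℝ _ c) x
      = (T - algebraMap ℝ _ c) x - (T - diagOp w) x := by simp
  have := norm_sub_le ((T - algebraMap ℝ _ c) x) ((T - diagOp w) x)
  rw [← hdiff] at this
  linarith

theorem norm_diagOp_sub_diagOp_apply (hw : IsBounded (range w)) (hv : IsBounded (range v))
    (x : ℓ²(ι, ℂ)) (n : ι) : ‖(diagOp w x - diagOp v x) n‖ = |w n - v n| * ‖x n‖ := by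
  rw [lp.coeFn_sub, Pi.sub_apply, diagOp_apply hw, diagOp_apply hv, ← sub_mul,
    ← Complex.ofReal_sub, norm_mul, Complex.norm_real, Real.norm_eq_abs]

theorem continuousOn_diagOp_apply (C : ℝ) (x : ℓ²(ι, ℂ)) :
    ContinuousOn (fun w => diagOp w x) {w : ι → ℝ | ∀ n, |w n| ≤ C} := by
  intro w hw
  have hbdd {v : ι → ℝ} (hv : ∀ n, |v n| ≤ C) : IsBounded (range v) :=
    isBounded_iff_forall_norm_le.mpr ⟨C, forall_mem_range.mpr hv⟩
  have hdom := tendsto_tsum_of_dominated_convergence (𝓕 := 𝓝[{w : ι → ℝ | ∀ n, |w n| ≤ C}] w)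
    (f := fun v n => ‖(diagOp v x - diagOp w x) n‖ ^ 2) (g := fun _ => 0)
    ((hasSum_norm_sq x).summable.mul_left ((2 * C) ^ 2)) (fun n => ?_) ?_
  · simp only [tsum_zero, (hasSum_norm_sq _).tsum_eq] at hdom
    exact tendsto_iff_norm_sub_tendsto_zero.mpr (by simpa using hdom.sqrt)
  · have hcont : Continuous fun v : ι → ℝ => (|v n - w n| * ‖x n‖) ^ 2 := by fun_prop
    have hlim : Tendsto (fun v : ι → ℝ => (|v n - w n| * ‖x n‖) ^ 2) (𝓝 w) (𝓝 0) := by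
      simpa using hcont.tendsto w
    refine (hlim.mono_left nhdsWithin_le_nhds).congr' ?_
    filter_upwards [self_mem_nhdsWithin] with v hv
    rw [norm_diagOp_sub_diagOp_apply (hbdd hv) (hbdd hw)]
  · filter_upwards [self_mem_nhdsWithin] with v hv n
    have hvw : |v n - w n| ≤ 2 * C := by
      linarith [abs_sub (v n) (w n), hv n, hw n]
    rw [norm_diagOp_sub_diagOp_apply (hbdd hv) (hbdd hw), Real.norm_of_nonneg (by positivity),
      mul_pow]
    gcongr

theorem isUnit_sub_diagOp_of_mem_closure {T : ℓ²(ι, ℂ) →L[ℂ] ℓ²(ι, ℂ)} (hT : IsSelfAdjoint T)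
    {W : Set (ι → ℝ)} {C c : ℝ} (hc : 0 < c) (hW : ∀ v ∈ W, ∀ n, |v n| ≤ C)
    (hcW : ∀ v ∈ W, ∀ x, c * ‖x‖ ≤ ‖(T - diagOp v) x‖) (hw : w ∈ closure W) :
    IsUnit (T - diagOp w) := by
  have hclosed : IsClosed {v : ι → ℝ | ∀ n, |v n| ≤ C} := by
    simp only [ofPred_forall]
    exact isClosed_iInter fun n => isClosed_le (by fun_prop) continuous_const
  refine isUnit_of_isSelfAdjoint_of_mul_norm_le (hT.sub (isSelfAdjoint_diagOp w)) hc fun x => ?_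
  have hmem : diagOp w x ∈ closure ((fun v => diagOp v x) '' W) :=
    ((continuousOn_diagOp_apply C x w (closure_minimal hW hclosed hw)).mono hW).mem_closure_image hw
  have hset : IsClosed {y : ℓ²(ι, ℂ) | c * ‖x‖ ≤ ‖T x - y‖} :=
    isClosed_le continuous_const (by fun_prop)
  have hsub : (fun v => diagOp v x) '' W ⊆ {y | c * ‖x‖ ≤ ‖T x - y‖} :=
    image_subset_iff.mpr fun v hv => hcW v hv x
  exact hset.closure_subset_iff.mpr hsub hmem

theorem memℓp_comp_equiv {ι' : Type*} (e : ι' ≃ ι) (x : ℓ²(ι, ℂ)) : Memℓp (fun n => x (e n)) 2 :=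
  memℓp_gen (by simpa [Function.comp_def] using e.summable_iff.mpr (hasSum_norm_sq x).summable)

/-- The unitary operator on `ℓ²` that relabels the coordinates along `e`. -/
def reindex {ι' : Type*} (e : ι ≃ ι') : ℓ²(ι, ℂ) ≃ₗᵢ[ℂ] ℓ²(ι', ℂ) where
  toFun x := ⟨fun n => x (e.symm n), memℓp_comp_equiv e.symm x⟩
  invFun x := ⟨fun n => x (e n), memℓp_comp_equiv e x⟩
  left_inv x := by ext; simp
  right_inv x := by ext; simp
  map_add' _ _ := rfl
  map_smul' _ _ := rfl
  norm_map' x := by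
    rw [← sq_eq_sq₀ (norm_nonneg _) (norm_nonneg _)]
    exact (hasSum_norm_sq _).unique (e.symm.hasSum_iff.mpr (hasSum_norm_sq x))

theorem reindex_apply {ι' : Type*} (e : ι ≃ ι') (x : ℓ²(ι, ℂ)) (n : ι') :
    reindex e x n = x (e.symm n) := rfl

theorem reindex_single {ι' : Type*} [DecidableEq ι] [DecidableEq ι'] (e : ι ≃ ι') (n : ι) (c : ℂ) :
    reindex e (lp.single 2 n c) = lp.single 2 (e n) c := by
  ext m
  rw [reindex_apply, lp.single_apply, lp.single_apply, Pi.single_apply, Pi.single_apply]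
  simp only [e.symm_apply_eq]

theorem reindex_diagOp {ι' : Type*} (e : ι ≃ ι') (hw : IsBounded (range w))
    (x : ℓ²(ι, ℂ)) : reindex e (diagOp w x) = diagOp (w ∘ e.symm) (reindex e x) := by
  have hwe : IsBounded (range (w ∘ e.symm)) := hw.subset (range_comp_subset_range _ _)
  ext n
  rw [diagOp_apply hwe, reindex_apply, reindex_apply, diagOp_apply hw, Function.comp_apply]

end DiagonalOperators

section BesselMultipliers

open Bornology ContinuousLinearMap

theorem isBounded_range_comp_of_mem_isCompact {ι α E : Type*} [TopologicalSpace α]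
    [PseudoMetricSpace E] {K : Set α} (hK : IsCompact K) {κ : ι → α} (hκ : ∀ n, κ n ∈ K)
    {f : α → E} (hf : ContinuousOn f K) : IsBounded (range fun n => f (κ n)) :=
  (hK.image_of_continuousOn hf).isBounded.subset
    (range_subset_iff.mpr fun n => mem_image_of_mem f (hκ n))

variable {ι H : Type*} [NormedAddCommGroup H] [InnerProductSpace ℂ H] [CompleteSpace H]
  {K : Set ℝ} {κ : ι → ℝ} {t : ℝ}

/-- The Gram operator `B B*` of the sequence `B* e_n`, where `B` is its analysis operator. -/
def gramOp (B : H →L[ℂ] ℓ²(ι, ℂ)) : ℓ²(ι, ℂ) →L[ℂ] ℓ²(ι, ℂ) := B ∘L adjoint B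

/-- The Bessel multiplier `B* D_κ B`, i.e. `∑ n, κ n ⟨·, ψ n⟩ ψ n` if `B` is the analysis operator
`x ↦ ⟨x, ψ n⟩` of `ψ`. -/
def besselMultiplier (B : H →L[ℂ] ℓ²(ι, ℂ)) (κ : ι → ℝ) : H →L[ℂ] H :=
  adjoint B ∘L diagOp κ ∘L B

theorem isPositive_gramOp (B : H →L[ℂ] ℓ²(ι, ℂ)) : (gramOp B).IsPositive :=
  isPositive_self_comp_adjoint B

theorem isSelfAdjoint_besselMultiplier (B : H →L[ℂ] ℓ²(ι, ℂ)) (κ : ι → ℝ) :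
    IsSelfAdjoint (besselMultiplier B κ) :=
  (isSelfAdjoint_diagOp κ).adjoint_conj B

variable {B : H →L[ℂ] ℓ²(ι, ℂ)}

theorem mem_spectrum_besselMultiplier_iff (hK : IsCompact K) (hpos : K ⊆ Ioi 0)
    (hκ : ∀ n, κ n ∈ K) (ht : t ≠ 0) :
    t ∈ spectrum ℝ (besselMultiplier B κ) ↔ ¬ IsUnit (gramOp B - diagOp fun n => t / κ n) := by
  have hκ0 (n : ι) : κ n ≠ 0 := (hpos (hκ n)).ne'
  have hw : IsBounded (range fun n => t / κ n) :=
    isBounded_range_comp_of_mem_isCompact hK hκ (continuousOn_const.div continuousOn_id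
      fun k hk => (hpos hk).ne')
  have hv : IsBounded (range fun n => κ n / t) :=
    isBounded_range_comp_of_mem_isCompact hK hκ (f := fun k => k / t) (by fun_prop)
  have hκb : IsBounded (range κ) := hK.isBounded.subset (range_subset_iff.mpr hκ)
  set W := diagOp fun n => t / κ n
  set V := diagOp fun n => κ n / t
  have hVW : V * W = 1 :=
    diagOp_mul_diagOp_eq_one hv hw fun n => div_mul_div_cancel₀' (hκ0 n) t t |>.trans (div_self ht)
  have hV : IsUnit V :=
    isUnit_diagOp hv (by simpa only [inv_div] using hw) fun n => div_ne_zero (hκ0 n) ht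
  have hκV : diagOp κ = t • V := by
    ext x n
    rw [diagOp_apply hκb, smul_apply, lp.coeFn_smul, Pi.smul_apply, diagOp_apply hv]
    simp only [Complex.ofReal_div, Complex.real_smul]
    field_simp [ht]
  have hleft : algebraMap ℝ _ t - besselMultiplier B κ
      = t • (1 - adjoint B ∘L (V ∘L B)) := by
    rw [besselMultiplier, hκV, smul_sub, Algebra.algebraMap_eq_smul_one, smul_comp, comp_smul]
  have hright : 1 - (V ∘L B) ∘L adjoint B = -(V * (gramOp B - W)) := by
    rw [mul_sub, hVW, neg_sub]
    rfl
  rw [spectrum.mem_iff, hleft, not_iff_not, ← Units.smul_mk0 ht, isUnit_smul_iff,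
    isUnit_one_sub_comp_comm, hright, IsUnit.neg_iff, ← hV.unit_spec, Units.isUnit_units_mul]

theorem zero_mem_spectrum_besselMultiplier_iff (hK : IsCompact K) (hpos : K ⊆ Ioi 0)
    (hκ : ∀ n, κ n ∈ K) :
    0 ∈ spectrum ℝ (besselMultiplier B κ) ↔ ¬ ∃ c > 0, ∀ x, c * ‖x‖ ≤ ‖B x‖ := by
  have hs : IsBounded (range fun n => √(κ n)) :=
    isBounded_range_comp_of_mem_isCompact hK hκ Real.continuous_sqrt.continuousOn
  have hκb : IsBounded (range κ) := hK.isBounded.subset (range_subset_iff.mpr hκ)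
  have hsq : (fun n => √(κ n) * √(κ n)) = κ :=
    funext fun n => Real.mul_self_sqrt (hpos (hκ n)).le
  set A := diagOp (fun n => √(κ n)) ∘L B
  have hA : besselMultiplier B κ = adjoint A ∘L A := by
    have hmul : diagOp (fun n => √(κ n)) * diagOp (fun n => √(κ n)) = diagOp κ := by
      rw [diagOp_mul_diagOp hs hs (by rwa [hsq]), hsq]
    rw [besselMultiplier, ← hmul, adjoint_comp, (isSelfAdjoint_diagOp _).adjoint_eq]
    rfl
  have hunit : IsUnit (diagOp fun n => √(κ n)) :=
    isUnit_diagOp hs (isBounded_range_comp_of_mem_isCompact hK hκ (f := fun k => (√k)⁻¹)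
      (Real.continuous_sqrt.continuousOn.inv₀ fun k hk => (Real.sqrt_pos.mpr (hpos hk)).ne'))
      fun n => (Real.sqrt_pos.mpr (hpos (hκ n))).ne'
  rw [spectrum.zero_mem_iff, not_iff_not, hA, isUnit_adjoint_comp_self_iff,
    exists_mul_norm_le_comp_iff hunit]

theorem mul_mem_spectrum_besselMultiplier_const_iff {k y : ℝ} (hk : 0 < k) (hy : y ≠ 0) :
    k * y ∈ spectrum ℝ (besselMultiplier B fun _ => k) ↔ y ∈ spectrum ℝ (gramOp B) := by
  rw [mem_spectrum_besselMultiplier_iff isCompact_singleton (singleton_subset_iff.mpr hk)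
    (fun _ => rfl) (mul_ne_zero hk.ne' hy), mul_div_cancel_left₀ y hk.ne', diagOp_const,
    spectrum.mem_iff, ← IsUnit.neg_iff, neg_sub]

theorem mem_mul_Icc_of_mem_spectrum_besselMultiplier [Nonempty ι] (hK : IsCompact K)
    (hpos : K ⊆ Ioi 0) (hκ : ∀ n, κ n ∈ K) {m M : ℝ} (hmM : m ≤ M)
    (hspec : spectrum ℝ (gramOp B) ⊆ Icc m M) (ht : t ≠ 0)
    (htκ : t ∈ spectrum ℝ (besselMultiplier B κ)) : t ∈ K * Icc m M := by
  by_contra hnot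
  have hcont : ContinuousOn (fun k => t / k) K :=
    continuousOn_const.div continuousOn_id fun k hk => (hpos hk).ne'
  obtain ⟨k₀, hk₀, hmin⟩ := hK.exists_isMinOn ⟨_, hκ (Classical.arbitrary ι)⟩
    (hcont.sub continuousOn_const).abs
  refine (mem_spectrum_besselMultiplier_iff hK hpos hκ ht).mp htκ
    (isUnit_sub_diagOp_of_gap (isPositive_gramOp B).isSelfAdjoint
      (isBounded_range_comp_of_mem_isCompact hK hκ hcont)
      (norm_sub_algebraMap_midpoint_le (isPositive_gramOp B).isSelfAdjoint hmM hspec)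
      ?_ fun n => hmin (hκ n))
  by_contra! hle
  have : t / k₀ ∈ Icc m M := by
    rw [Pi.sub_apply] at hle
    rw [midpoint_eq_smul_add, smul_eq_mul, invOf_eq_inv] at hle
    constructor <;> linarith [abs_le.mp hle]
  exact hnot ⟨k₀, hk₀, t / k₀, this, mul_div_cancel₀ _ (hpos hk₀).ne'⟩

/-- The union of the spectra of all Bessel multipliers whose coefficients lie in `K`. For `K` the
support of `P₀` this is the deterministic spectrum. -/
def multiplierSpectrum (B : H →L[ℂ] ℓ²(ι, ℂ)) (K : Set ℝ) : Set ℝ :=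
  {t | ∃ κ : ι → ℝ, (∀ n, κ n ∈ K) ∧ t ∈ spectrum ℝ (besselMultiplier B κ)}

end BesselMultipliers

section Translations

open Bornology

/-- `T` is a Laurent operator, encoded as a bounded operator on `ℓ²(ℤ)` that commutes with all
translations. -/
def IsLaurentOp (T : EllTwo →L[ℂ] EllTwo) : Prop :=
  ∀ (j : ℤ) (x : EllTwo),
    T (reindex (Equiv.subRight j) x) = reindex (Equiv.subRight j) (T x)

theorem isUnit_sub_diagOp_of_mem_closure_translates {T : EllTwo →L[ℂ] EllTwo}
    (hT : IsSelfAdjoint T) (hTL : IsLaurentOp T) {w v : ℤ → ℝ} (hw : IsBounded (range w))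
    (h : IsUnit (T - diagOp w)) (hv : v ∈ closure (range fun (j : ℤ) (n : ℤ) => w (n + j))) :
    IsUnit (T - diagOp v) := by
  obtain ⟨c, hc, hcx⟩ := exists_mul_norm_le_of_isUnit h
  obtain ⟨C, hC⟩ := isBounded_iff_forall_norm_le.mp hw
  refine isUnit_sub_diagOp_of_mem_closure hT hc (C := C) ?_ ?_ hv
  · rintro _ ⟨j, rfl⟩ n
    exact hC _ (mem_range_self _)
  · rintro _ ⟨j, rfl⟩ x
    obtain ⟨y, rfl⟩ := (reindex (Equiv.subRight j)).surjective x
    have hdiag := reindex_diagOp (Equiv.subRight j) hw y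
    calc c * ‖reindex (Equiv.subRight j) y‖ = c * ‖y‖ := by rw [LinearIsometryEquiv.norm_map]
      _ ≤ ‖(T - diagOp w) y‖ := hcx y
      _ = ‖reindex (Equiv.subRight j) ((T - diagOp w) y)‖ := by rw [LinearIsometryEquiv.norm_map]
      _ = _ := by rw [sub_apply, map_sub, hdiag, ← hTL]; rfl

variable {H : Type*} [NormedAddCommGroup H] [InnerProductSpace ℂ H] [CompleteSpace H]
  {B : H →L[ℂ] EllTwo} {K : Set ℝ} {κ : ℤ → ℝ}

theorem spectrum_besselMultiplier_eq_of_isTypical (hB : IsLaurentOp (gramOp B)) (hK : IsCompact K)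
    (hpos : K ⊆ Ioi 0) (hκ : IsTypical K κ) :
    spectrum ℝ (besselMultiplier B κ) = multiplierSpectrum B K := by
  refine Subset.antisymm (fun t ht => ⟨κ, hκ.1, ht⟩) ?_
  rintro t ⟨κ', hκ', ht⟩
  rcases eq_or_ne t 0 with rfl | ht0
  · rwa [zero_mem_spectrum_besselMultiplier_iff hK hpos hκ.1,
      ← zero_mem_spectrum_besselMultiplier_iff hK hpos hκ']
  rw [mem_spectrum_besselMultiplier_iff hK hpos hκ' ht0] at ht
  rw [mem_spectrum_besselMultiplier_iff hK hpos hκ.1 ht0]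
  refine mt (fun h => isUnit_sub_diagOp_of_mem_closure_translates
    (isPositive_gramOp B).isSelfAdjoint hB ?_ h ?_) ht
  · exact isBounded_range_comp_of_mem_isCompact hK hκ.1 (continuousOn_const.div continuousOn_id
      fun k hk => (hpos hk).ne')
  · have hcont : ContinuousAt (fun (v : ℤ → ℝ) n => t / v n) κ' :=
      continuousAt_pi.mpr fun n => continuousAt_const.div (continuousAt_apply n κ')
        (hpos (hκ' n)).ne'
    have := mem_closure_image hcont (hκ.2 fun n _ => hκ' n)
    rwa [← range_comp] at this

end Translations

section AnalysisOperators

open Bornology ContinuousLinearMap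

theorem sum_norm_inner_sq_le_of_norm_sum_smul_sq_le {𝕜 E ι : Type*} [RCLike 𝕜]
    [NormedAddCommGroup E] [InnerProductSpace 𝕜 E] {ψ : ι → E} {s : Finset ι} {C : ℝ}
    (hC0 : 0 ≤ C) (hC : ∀ a : ι → 𝕜, ‖∑ n ∈ s, a n • ψ n‖ ^ 2 ≤ C * ∑ n ∈ s, ‖a n‖ ^ 2) (x : E) :
    ∑ n ∈ s, ‖inner 𝕜 (ψ n) x‖ ^ 2 ≤ C * ‖x‖ ^ 2 := by
  set Q := ∑ n ∈ s, ‖inner 𝕜 (ψ n) x‖ ^ 2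
  set y := ∑ n ∈ s, inner 𝕜 (ψ n) x • ψ n
  have hinner : inner 𝕜 y x = (Q : 𝕜) := by
    rw [sum_inner, RCLike.ofReal_sum]
    refine Finset.sum_congr rfl fun n _ => ?_
    rw [inner_smul_left, RCLike.conj_mul, RCLike.ofReal_pow]
  have hQ : 0 ≤ Q := Finset.sum_nonneg fun n _ => by positivity
  have hcs : Q ≤ ‖y‖ * ‖x‖ := by
    have := norm_inner_le_norm (𝕜 := 𝕜) y x
    rwa [hinner, RCLike.norm_ofReal, abs_of_nonneg hQ] at this
  rcases hQ.eq_or_lt with h0 | hpos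
  · rw [← h0]
    positivity
  · refine le_of_mul_le_mul_right ?_ hpos
    calc Q * Q ≤ (‖y‖ * ‖x‖) * (‖y‖ * ‖x‖) := mul_self_le_mul_self hQ hcs
      _ = ‖y‖ ^ 2 * ‖x‖ ^ 2 := by ring
      _ ≤ C * Q * ‖x‖ ^ 2 := by gcongr; exact hC _
      _ = C * ‖x‖ ^ 2 * Q := by ring

variable {H : Type*} [NormedAddCommGroup H] [InnerProductSpace ℂ H]

theorem norm_sum_smul_sq_le_of_isBoundedMatrix {ψ : ℤ → H}
    (h : IsBoundedMatrix (gramMatrix ψ)) : ∃ C ≥ 0, ∀ (s : Finset ℤ) (a : ℤ → ℂ),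
      ‖∑ n ∈ s, a n • ψ n‖ ^ 2 ≤ C * ∑ n ∈ s, ‖a n‖ ^ 2 := by
  obtain ⟨T, hT⟩ := h
  refine ⟨‖T‖, norm_nonneg T, fun s a => ?_⟩
  set y := ∑ n ∈ s, a n • ψ n
  set v : EllTwo := ∑ n ∈ s, star (a n) • lp.single 2 n (1 : ℂ)
  have hv : ‖v‖ ^ 2 = ∑ n ∈ s, ‖a n‖ ^ 2 := by
    have := lp.norm_sum_single (E := fun _ : ℤ => ℂ) (p := 2) (by norm_num) (fun n => star (a n)) s
    simpa [v, ← lp.single_smul] using this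
  have hinner : inner ℂ v (T v) = inner ℂ y y := by
    simp only [v, y, sum_inner, map_sum, inner_sum, map_smul, inner_smul_left, inner_smul_right,
      lp.inner_single_left, hT, gramMatrix, Finset.mul_sum]
    rw [Finset.sum_comm]
    refine Finset.sum_congr rfl fun n _ => Finset.sum_congr rfl fun m _ => ?_
    rw [RCLike.inner_apply, map_one, mul_one, starRingEnd_apply, starRingEnd_apply, star_star]
    ring
  calc ‖y‖ ^ 2 = ‖inner ℂ v (T v)‖ := by
        rw [hinner, inner_self_eq_norm_sq_to_K, norm_pow, RCLike.norm_ofReal, abs_norm]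
    _ ≤ ‖v‖ * (‖T‖ * ‖v‖) := (norm_inner_le_norm _ _).trans (by gcongr; exact T.le_opNorm v)
    _ = ‖T‖ * ∑ n ∈ s, ‖a n‖ ^ 2 := by rw [← hv]; ring

/-- `B` is the analysis operator `x ↦ (⟨x, ψ n⟩)` of the sequence `ψ`. -/
def IsAnalysisOp {ι : Type*} (ψ : ι → H) (B : H →L[ℂ] ℓ²(ι, ℂ)) : Prop :=
  ∀ x n, B x n = inner ℂ (ψ n) x

theorem exists_isAnalysisOp {ι : Type*} {ψ : ι → H} {C : ℝ} (hC0 : 0 ≤ C)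
    (hC : ∀ (s : Finset ι) (x : H), ∑ n ∈ s, ‖inner ℂ (ψ n) x‖ ^ 2 ≤ C * ‖x‖ ^ 2) :
    ∃ B : H →L[ℂ] ℓ²(ι, ℂ), IsAnalysisOp ψ B := by
  have hmem (x : H) : Memℓp (fun n => inner ℂ (ψ n) x) 2 :=
    memℓp_gen' (C := C * ‖x‖ ^ 2) fun s => by simpa using hC s x
  let B : H →ₗ[ℂ] ℓ²(ι, ℂ) :=
    { toFun := fun x => ⟨fun n => inner ℂ (ψ n) x, hmem x⟩
      map_add' := fun x y => by ext n; exact inner_add_right _ _ _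
      map_smul' := fun c x => by ext n; exact inner_smul_right _ _ _ }
  refine ⟨B.mkContinuous (√C) fun x => ?_, fun x n => rfl⟩
  refine lp.norm_le_of_forall_sum_le (by norm_num) (by positivity) fun s => ?_
  simpa [B, mul_pow, Real.sq_sqrt hC0] using hC s x

theorem exists_isAnalysisOp_of_isBoundedMatrix {ψ : ℤ → H} (h : IsBoundedMatrix (gramMatrix ψ)) :
    ∃ B : H →L[ℂ] EllTwo, IsAnalysisOp ψ B :=
  let ⟨_, hC0, hC⟩ := norm_sum_smul_sq_le_of_isBoundedMatrix h
  exists_isAnalysisOp hC0 fun s => sum_norm_inner_sq_le_of_norm_sum_smul_sq_le hC0 (hC s)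

theorem IsAnalysisOp.ker_eq {ι : Type*} {ψ : ι → H} {B : H →L[ℂ] ℓ²(ι, ℂ)}
    (hB : IsAnalysisOp ψ B) : B.ker = (Submodule.span ℂ (range ψ))ᗮ := by
  ext x
  rw [← Submodule.span_singleton_le_iff_mem x (_ᗮ), ← Submodule.isOrtho_iff_le,
    Submodule.isOrtho_comm, Submodule.isOrtho_span, LinearMap.mem_ker, coe_coe, lp.ext_iff,
    funext_iff]
  simp only [mem_singleton_iff, forall_mem_range, forall_eq, hB x, lp.coeFn_zero, Pi.zero_apply]

theorem gramMatrix_add_add {ψ : ℤ → H}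
    (h : ∀ n m, gramMatrix ψ (n + 1) (m + 1) = gramMatrix ψ n m) (n m j : ℤ) :
    gramMatrix ψ (n + j) (m + j) = gramMatrix ψ n m := by
  induction j with
  | zero => simp only [add_zero]
  | succ j ih => rw [← add_assoc, ← add_assoc, h, ih]
  | pred j ih => rw [← ih, ← h, add_assoc, add_assoc, sub_add_cancel]

variable [CompleteSpace H]

theorem IsAnalysisOp.adjoint_single {ι : Type*} [DecidableEq ι] {ψ : ι → H}
    {B : H →L[ℂ] ℓ²(ι, ℂ)} (hB : IsAnalysisOp ψ B) (n : ι) (c : ℂ) :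
    adjoint B (lp.single 2 n c) = c • ψ n := by
  refine ext_inner_right ℂ fun x => ?_
  rw [adjoint_inner_left, lp.inner_single_left, hB, inner_smul_left, RCLike.inner_apply, mul_comm]

variable {ψ : ℤ → H} {B : H →L[ℂ] EllTwo}

theorem IsAnalysisOp.isRandomSum_besselMultiplier (hB : IsAnalysisOp ψ B) {κ : ℤ → ℝ}
    (hκ : IsBounded (range κ)) : IsRandomSum ψ κ (besselMultiplier B κ) := by
  intro x
  have h := (lp.hasSum_single (by norm_num) (diagOp κ (B x))).mapL (adjoint B)
  rw [HasSum, SummationFilter.unconditional_filter] at h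
  refine (h.comp Finset.tendsto_Icc_neg).congr fun N => ?_
  rw [partialOp, sum_apply]
  refine Finset.sum_congr rfl fun n _ => ?_
  rw [hB.adjoint_single, diagOp_apply hκ, hB, smul_apply, InnerProductSpace.rankOne_apply,
    smul_smul]

theorem IsAnalysisOp.gramOp_single (hB : IsAnalysisOp ψ B) (m n : ℤ) :
    gramOp B (lp.single 2 m 1) n = gramMatrix ψ m n := by
  rw [gramOp, comp_apply, hB.adjoint_single, one_smul, hB, gramMatrix]

theorem IsAnalysisOp.isLaurentOp_gramOp (hB : IsAnalysisOp ψ B)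
    (h : ∀ n m, gramMatrix ψ (n + 1) (m + 1) = gramMatrix ψ n m) : IsLaurentOp (gramOp B) := by
  intro j
  suffices hcomp : gramOp B ∘L (reindex (Equiv.subRight j)).toLinearIsometry.toContinuousLinearMap
      = (reindex (Equiv.subRight j)).toLinearIsometry.toContinuousLinearMap ∘L gramOp B from
    fun x => congr($hcomp x)
  refine lp.ext_continuousLinearMap (by norm_num) fun m => ContinuousLinearMap.ext_ring ?_
  ext n
  change gramOp B (reindex (Equiv.subRight j) (lp.single 2 m 1)) n
    = reindex (Equiv.subRight j) (gramOp B (lp.single 2 m 1)) n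
  rw [reindex_single, reindex_apply, hB.gramOp_single, hB.gramOp_single,
    ← gramMatrix_add_add h _ n j]
  simp

end AnalysisOperators

section MultiplicationOperators

variable {X F : Type*} [MeasurableSpace X] {μ : Measure X} [NormedAddCommGroup F]
  [InnerProductSpace ℂ F] {U : Lp ℂ 2 μ ≃ₗᵢ[ℂ] F} {φ : X → ℝ} {T : F →L[ℂ] F}

/-- The unitary operator `U` transforms `T` into multiplication by `φ`. The function `φ` need not
be bounded a priori, so the relation is stated for those `f` whose product with `φ` is in `L²`. -/
def IsMultiplicationVia (U : Lp ℂ 2 μ ≃ₗᵢ[ℂ] F) (φ : X → ℝ) (T : F →L[ℂ] F) : Prop :=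
  ∀ f g : Lp ℂ 2 μ, (∀ᵐ x ∂μ, g x = φ x * f x) → T (U f) = U g

theorem IsMultiplicationVia.sub_algebraMap_apply (hT : IsMultiplicationVia U φ T) {t : ℝ}
    {f g : Lp ℂ 2 μ} (hfg : ∀ᵐ x ∂μ, g x = (φ x - t : ℝ) * f x) :
    (T - algebraMap ℝ (F →L[ℂ] F) t) (U f) = U g := by
  have hsum : T (U f) = U (g + (t : ℂ) • f) := hT f _ (by
    filter_upwards [hfg, Lp.coeFn_add g ((t : ℂ) • f), Lp.coeFn_smul (t : ℂ) f] with x h1 h2 h3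
    rw [h2, Pi.add_apply, h3, Pi.smul_apply, h1, smul_eq_mul, ← add_mul, ← Complex.ofReal_add,
      sub_add_cancel])
  rw [sub_apply, hsum, map_add, map_smul, Algebra.algebraMap_eq_smul_one, smul_apply,
    one_apply_eq_self, Complex.coe_smul, add_sub_cancel_right]

theorem exists_lp_ae_eq_mul {u : X → ℝ} (hu : Measurable u) {C : ℝ} (f : Lp ℂ 2 μ)
    (h : ∀ᵐ x ∂μ, |u x| * ‖f x‖ ≤ C * ‖f x‖) :
    ∃ g : Lp ℂ 2 μ, (∀ᵐ x ∂μ, g x = u x * f x) ∧ ‖g‖ ≤ C * ‖f‖ := by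
  have hmem : MemLp (fun x => (u x : ℂ) * f x) 2 μ := by
    refine (Lp.memLp f).of_le_mul (c := C) ((Complex.measurable_ofReal.comp
      hu).aestronglyMeasurable.mul (Lp.aestronglyMeasurable f)) ?_
    filter_upwards [h] with x hx
    rwa [norm_mul, Complex.norm_real, Real.norm_eq_abs]
  refine ⟨hmem.toLp, hmem.coeFn_toLp, Lp.norm_le_mul_norm_of_ae_le_mul ?_⟩
  filter_upwards [h, hmem.coeFn_toLp] with x hx hcoe
  rwa [hcoe, norm_mul, Complex.norm_real, Real.norm_eq_abs]

theorem IsMultiplicationVia.support_subset_spectrum [IsFiniteMeasure μ] [CompleteSpace F]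
    (hT : IsMultiplicationVia U φ T) (hφ : Measurable φ) :
    (μ.map φ).support ⊆ spectrum ℝ T := by
  intro t ht hunit
  rw [spectrum.mem_resolventSet_iff, ← IsUnit.neg_iff, neg_sub] at hunit
  obtain ⟨c, hc, hcx⟩ := exists_mul_norm_le_of_isUnit hunit
  set S := φ ⁻¹' Metric.ball t (c / 2)
  have hS : MeasurableSet S := hφ measurableSet_ball
  have hμS : 0 < μ S := by
    rw [← Measure.map_apply hφ measurableSet_ball]
    exact (Measure.mem_support_iff_forall _).mp ht _ (Metric.ball_mem_nhds t (half_pos hc))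
  set f : Lp ℂ 2 μ := indicatorConstLp 2 hS (measure_ne_top _ _) 1
  have hf : 0 < ‖f‖ := by
    have : 0 < μ.real S := ENNReal.toReal_pos hμS.ne' (measure_ne_top _ _)
    rw [norm_indicatorConstLp (by norm_num) (by norm_num), norm_one, one_mul]
    positivity
  obtain ⟨g, hg, hgf⟩ := exists_lp_ae_eq_mul (u := fun x => φ x - t) (hφ.sub_const t) (C := c / 2)
    f (by
      filter_upwards [indicatorConstLp_coeFn (p := 2) (hs := hS) (hμs := measure_ne_top μ S)
        (c := (1 : ℂ))] with x hx
      by_cases hxS : x ∈ S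
      · exact mul_le_mul_of_nonneg_right (le_of_lt hxS) (norm_nonneg _)
      · rw [hx, indicator_of_notMem hxS, norm_zero, mul_zero, mul_zero])
  have := hcx (U f)
  rw [hT.sub_algebraMap_apply hg, U.norm_map, U.norm_map] at this
  linarith [mul_pos hc hf]

theorem IsMultiplicationVia.spectrum_subset_support [CompleteSpace F] (hTs : IsSelfAdjoint T)
    (hT : IsMultiplicationVia U φ T) (hφ : Measurable φ) :
    spectrum ℝ T ⊆ (μ.map φ).support := by
  intro t ht
  by_contra hnot
  obtain ⟨ε, hε, hball⟩ : ∃ ε > 0, μ (φ ⁻¹' Metric.ball t ε) = 0 := by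
    simpa only [Metric.nhds_basis_ball.mem_measureSupport, not_forall, exists_prop, not_lt,
      nonpos_iff_eq_zero, Measure.map_apply hφ measurableSet_ball] using hnot
  refine ht ?_
  rw [spectrum.mem_resolventSet_iff, ← IsUnit.neg_iff, neg_sub]
  refine isUnit_of_isSelfAdjoint_of_surjective (hTs.sub (.algebraMap _ (.all t))) fun y => ?_
  obtain ⟨f, rfl⟩ := U.surjective y
  have hfar : ∀ᵐ x ∂μ, ε ≤ |φ x - t| :=
    (measure_eq_zero_iff_ae_notMem.mp hball).mono fun x hx => not_lt.mp hx
  obtain ⟨g, hg, -⟩ := exists_lp_ae_eq_mul (u := fun x => (φ x - t)⁻¹) (hφ.sub_const t).inv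
    (C := ε⁻¹) f (by
      filter_upwards [hfar] with x hx
      rw [abs_inv]
      gcongr)
  refine ⟨U g, hT.sub_algebraMap_apply ?_⟩
  filter_upwards [hg, hfar] with x hgx hx
  have : φ x - t ≠ 0 := abs_pos.mp (hε.trans_le hx)
  rw [hgx, ← mul_assoc, ← Complex.ofReal_mul, mul_inv_cancel₀ this, Complex.ofReal_one, one_mul]

theorem IsMultiplicationVia.spectrum_eq [IsFiniteMeasure μ] [CompleteSpace F]
    (hTs : IsSelfAdjoint T) (hT : IsMultiplicationVia U φ T) (hφ : Measurable φ) :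
    spectrum ℝ T = (μ.map φ).support :=
  (hT.spectrum_subset_support hTs hφ).antisymm (hT.support_subset_spectrum hφ)

end MultiplicationOperators

section Symbol

open ContinuousLinearMap ComplexConjugate

theorem essRan_eq_support {f : Circ → ℝ} (hf : Measurable f) :
    essRan f = (circMeas.map f).support := by
  ext a
  rw [Metric.nhds_basis_ball.mem_measureSupport]
  refine forall₂_congr fun ε _ => ?_
  rw [Measure.map_apply hf measurableSet_ball]
  rfl

/-- The unitary operator `L²(𝕋) → ℓ²(ℤ)` that takes `e^{ink}` to the basis vector `e_{-n}`. With
this orientation the Gram operator `(⟨ψ m, ψ n⟩)ₙₘ` becomes multiplication by the symbol. -/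
def fourierEquiv : Lp ℂ 2 circMeas ≃ₗᵢ[ℂ] EllTwo :=
  (fourierBasis (T := 2 * Real.pi)).repr.trans (reindex (Equiv.neg ℤ))

theorem fourierEquiv_apply (f : Lp ℂ 2 circMeas) (n : ℤ) :
    fourierEquiv f n = fourierCoeff f (-n) := by
  rw [fourierEquiv, LinearIsometryEquiv.trans_apply, reindex_apply, fourierBasis_repr]
  rfl

theorem fourierEquiv_star_apply (f : Lp ℂ 2 circMeas) (n : ℤ) :
    fourierEquiv (star f) n = star (fourierEquiv f (-n)) := by
  have hconj : fourierCoeff (star (f : Circ → ℂ)) (-n) = conj (fourierCoeff f n) := by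
    rw [fourierCoeff, fourierCoeff, ← integral_conj]
    congr 1 with x
    rw [smul_eq_mul, smul_eq_mul, map_mul, ← fourier_neg, neg_neg]
    rfl
  rw [fourierEquiv_apply, fourierEquiv_apply, fourierCoeff_congr_ae (Lp.coeFn_star f), hconj,
    neg_neg]
  rfl

theorem IsLaurentOp.apply_single {T : EllTwo →L[ℂ] EllTwo} (hT : IsLaurentOp T) (n m : ℤ) :
    T (lp.single 2 n 1) m = T (lp.single 2 0 1) (m - n) := by
  have := hT (-n) (lp.single 2 0 1)
  rw [reindex_single] at this
  simpa [reindex_apply, sub_eq_add_neg] using congr($this m)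

theorem IsLaurentOp.star_eq_self {T : EllTwo →L[ℂ] EllTwo} (hT : IsLaurentOp T)
    (hTs : IsSelfAdjoint T) {h : Lp ℂ 2 circMeas} (hh : fourierEquiv h = T (lp.single 2 0 1)) :
    star h = h := by
  refine fourierEquiv.injective (lp.ext (funext fun n => ?_))
  have := hTs.isSymmetric (lp.single 2 n 1) (lp.single 2 0 1)
  rw [coe_coe, lp.inner_single_right, lp.inner_single_left, hT.apply_single, zero_sub] at this
  rw [fourierEquiv_star_apply, hh]
  simpa [RCLike.inner_apply] using this

theorem fourierEquiv_modulation {h g : Lp ℂ 2 circMeas} {n : ℤ}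
    (hg : ∀ᵐ x ∂circMeas, g x = fourier (-n) x * h x) (m : ℤ) :
    fourierEquiv g m = fourierEquiv h (m - n) := by
  rw [fourierEquiv_apply, fourierEquiv_apply, fourierCoeff_congr_ae hg]
  simp only [fourierCoeff, smul_eq_mul]
  congr 1 with x
  rw [← mul_assoc, ← fourier_add]
  congr 3
  ring

theorem IsLaurentOp.isMultiplicationVia {T : EllTwo →L[ℂ] EllTwo} (hT : IsLaurentOp T)
    (hTs : IsSelfAdjoint T) {h : Lp ℂ 2 circMeas} (hh : fourierEquiv h = T (lp.single 2 0 1)) :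
    IsMultiplicationVia fourierEquiv (fun x => (h x).re) T := by
  have hreal : ∀ᵐ x ∂circMeas, ((h x).re : ℂ) = h x := by
    have hstar := Lp.coeFn_star h
    rw [hT.star_eq_self hTs hh] at hstar
    exact hstar.mono fun x hx => Complex.conj_eq_iff_re.mp hx.symm
  intro f g hfg
  ext n
  have hmem : MemLp (fun x => fourier (-n) x * h x) 2 circMeas :=
    (Lp.memLp h).congr_norm ((fourier (-n)).continuous.aestronglyMeasurable.mul
      (Lp.aestronglyMeasurable h)) (.of_forall fun x => by simp [Circle.norm_coe])
  have hcol : T (lp.single 2 n 1) = fourierEquiv hmem.toLp := by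
    ext m
    rw [hT.apply_single, ← hh, fourierEquiv_modulation hmem.coeFn_toLp]
  calc T (fourierEquiv f) n = inner ℂ (lp.single 2 n (1 : ℂ)) (T (fourierEquiv f)) := by
        rw [lp.inner_single_left, RCLike.inner_apply, map_one, mul_one]
    _ = inner ℂ (fourierEquiv hmem.toLp) (fourierEquiv f) := by
        rw [← hcol]
        exact (hTs.isSymmetric _ _).symm
    _ = inner ℂ hmem.toLp f := fourierEquiv.inner_map_map _ _
    _ = fourierCoeff g (-n) := by
        rw [fourierCoeff, L2.inner_def]
        refine integral_congr_ae ?_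
        filter_upwards [hmem.coeFn_toLp, hreal, hfg] with x h1 h2 h3
        rw [RCLike.inner_apply, h1, h3, ← h2, map_mul, Complex.conj_ofReal, fourier_neg,
          Complex.conj_conj, smul_eq_mul, neg_neg, Complex.ofReal_re]
        ring
    _ = fourierEquiv g n := (fourierEquiv_apply g n).symm

variable {H : Type*} [NormedAddCommGroup H] [InnerProductSpace ℂ H]

theorem measurable_symbol (ψ : ℤ → H) : Measurable (symbol ψ) :=
  Complex.measurable_re.comp (Lp.stronglyMeasurable (symbolLp ψ)).measurable

variable [CompleteSpace H] {ψ : ℤ → H} {B : H →L[ℂ] EllTwo}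

theorem IsAnalysisOp.fourierEquiv_symbolLp (hB : IsAnalysisOp ψ B)
    (hL : IsLaurentOp (gramOp B)) : fourierEquiv (symbolLp ψ) = gramOp B (lp.single 2 0 1) := by
  rw [← LinearIsometryEquiv.eq_symm_apply]
  have h := fourierBasis (T := 2 * Real.pi).hasSum_repr_symm
    (reindex (Equiv.neg ℤ) (gramOp B (lp.single 2 0 1)))
  rw [coe_fourierBasis] at h
  refine .trans (tsum_congr fun n => ?_) h.tsum_eq
  rw [reindex_apply, ← hB.gramOp_single, hL.apply_single, zero_sub]
  rfl

theorem IsAnalysisOp.spectrum_gramOp (hB : IsAnalysisOp ψ B) (hL : IsLaurentOp (gramOp B)) :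
    spectrum ℝ (gramOp B) = essRan (symbol ψ) := by
  rw [essRan_eq_support (measurable_symbol ψ)]
  have hs := (isPositive_gramOp B).isSelfAdjoint
  exact (hL.isMultiplicationVia hs (hB.fourierEquiv_symbolLp hL)).spectrum_eq hs
    (measurable_symbol ψ)

end Symbol

section MultiplierSpectrum

open ContinuousLinearMap

theorem exists_mul_norm_le_of_injective_of_isUnit_comp {𝕜 E F : Type*} [NontriviallyNormedField 𝕜]
    [NormedAddCommGroup E] [NormedSpace 𝕜 E] [NormedAddCommGroup F] [NormedSpace 𝕜 F]
    {A : F →L[𝕜] E} {B : E →L[𝕜] F} (hB : Function.Injective B) (h : IsUnit (B ∘L A)) :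
    ∃ c > 0, ∀ x, c * ‖x‖ ≤ ‖B x‖ := by
  obtain ⟨G, hG⟩ := h.exists_right_inv
  refine exists_mul_norm_le_of_isUnit_comp (A := A ∘L G) ?_
  suffices h1 : (A ∘L G) ∘L B = 1 from h1 ▸ isUnit_one
  ext x
  exact hB congr($hG (B x))

theorem closedConvexHull_eq_Icc {R : Set ℝ} (hR : IsCompact R) (hne : R.Nonempty) :
    closedConvexHull ℝ R = Icc (sInf R) (sSup R) :=
  (closedConvexHull_min (subset_Icc_csInf_csSup hR.bddBelow hR.bddAbove) (convex_Icc _ _)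
    isClosed_Icc).antisymm (convex_closedConvexHull.ordConnected.out
      (subset_closedConvexHull (hR.sInf_mem hne)) (subset_closedConvexHull (hR.sSup_mem hne)))

variable {ι H : Type*} [NormedAddCommGroup H] [InnerProductSpace ℂ H] [CompleteSpace H]
  {B : H →L[ℂ] ℓ²(ι, ℂ)} {K : Set ℝ}

theorem zero_mem_multiplierSpectrum_iff (hK : IsCompact K) (hne : K.Nonempty) (hpos : K ⊆ Ioi 0) :
    0 ∈ multiplierSpectrum B K ↔ ¬ ∃ c > 0, ∀ x, c * ‖x‖ ≤ ‖B x‖ := by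
  constructor
  · rintro ⟨κ, hκ, h⟩
    exact (zero_mem_spectrum_besselMultiplier_iff hK hpos hκ).mp h
  · obtain ⟨k, hk⟩ := hne
    exact fun h => ⟨fun _ => k, fun _ => hk,
      (zero_mem_spectrum_besselMultiplier_iff hK hpos fun _ => hk).mpr h⟩

theorem mul_spectrum_gramOp_diff_zero_subset (hpos : K ⊆ Ioi 0) :
    (K * spectrum ℝ (gramOp B)) \ {0} ⊆ multiplierSpectrum B K := by
  rintro _ ⟨⟨k, hk, y, hy, rfl⟩, hne⟩
  exact ⟨fun _ => k, fun _ => hk, (mul_mem_spectrum_besselMultiplier_const_iff (hpos hk)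
    (right_ne_zero_of_mul hne)).mpr hy⟩

theorem multiplierSpectrum_diff_zero_subset [Nonempty ι] (hK : IsCompact K) (hpos : K ⊆ Ioi 0)
    (hne : (spectrum ℝ (gramOp B)).Nonempty) :
    multiplierSpectrum B K \ {0} ⊆ K * closedConvexHull ℝ (spectrum ℝ (gramOp B)) := by
  have hcpt : IsCompact (spectrum ℝ (gramOp B)) := spectrum.isCompact _
  have hhull := closedConvexHull_eq_Icc hcpt hne
  rw [hhull]
  rintro t ⟨⟨κ, hκ, ht⟩, ht0⟩
  exact mem_mul_Icc_of_mem_spectrum_besselMultiplier hK hpos hκ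
    (csInf_le_csSup hne hcpt.bddBelow hcpt.bddAbove) (hhull ▸ subset_closedConvexHull) ht0 ht

theorem zero_mem_multiplierSpectrum_of_accPt (hne : K.Nonempty) (hpos : K ⊆ Ioi 0)
    (h : AccPt 0 (𝓟 (spectrum ℝ (gramOp B)))) : 0 ∈ multiplierSpectrum B K := by
  obtain ⟨k, hk⟩ := hne
  have hlim : Tendsto (k * ·) (𝓝 0) (𝓝 0) := by
    simpa only [mul_zero] using (continuous_const_mul k).tendsto 0
  exact ⟨fun _ => k, fun _ => hk, (spectrum.isClosed _).mem_of_frequently_of_tendsto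
    ((accPt_iff_frequently.mp h).mono fun y hy =>
      (mul_mem_spectrum_besselMultiplier_const_iff (hpos hk) hy.1).mpr hy.2) hlim⟩

theorem IsAnalysisOp.isCompleteSeq_iff {ψ : ℤ → H} {B : H →L[ℂ] EllTwo} (hB : IsAnalysisOp ψ B) :
    IsCompleteSeq ψ ↔ Function.Injective B := by
  rw [IsCompleteSeq, Submodule.topologicalClosure_eq_top_iff, ← hB.ker_eq, LinearMap.ker_eq_bot]
  rfl

theorem IsAnalysisOp.zero_mem_multiplierSpectrum_iff {ψ : ℤ → H} {B : H →L[ℂ] EllTwo}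
    (hB : IsAnalysisOp ψ B) (hspec : spectrum ℝ (gramOp B) = essRan (symbol ψ)) (hK : IsCompact K)
    (hne : K.Nonempty) (hpos : K ⊆ Ioi 0) (hZ : ZeroCompatible ψ) :
    0 ∈ multiplierSpectrum B K ↔ 0 ∈ essRan (symbol ψ) := by
  by_cases hψ : IsCompleteSeq ψ
  · refine ⟨fun h0 => ?_, fun h0 => zero_mem_multiplierSpectrum_of_accPt hne hpos
      (hspec ▸ hZ.2 hψ h0)⟩
    rw [← hspec, spectrum.zero_mem_iff]
    exact fun hunit => (RandomProjections.zero_mem_multiplierSpectrum_iff hK hne hpos).mp h0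
      (exists_mul_norm_le_of_injective_of_isUnit_comp (hB.isCompleteSeq_iff.mp hψ) hunit)
  · refine iff_of_true ((RandomProjections.zero_mem_multiplierSpectrum_iff hK hne hpos).mpr ?_)
      (hZ.1 hψ)
    rintro ⟨c, hc, hcx⟩
    refine hψ (hB.isCompleteSeq_iff.mpr ((injective_iff_map_eq_zero B).mpr fun x hx => ?_))
    have := hcx x
    rw [hx, norm_zero] at this
    exact norm_le_zero_iff.mp (nonpos_of_mul_nonpos_right this hc)

end MultiplierSpectrum

section DeterministicSpectrum

open Bornology ContinuousLinearMap

variable {H : Type*} [NormedAddCommGroup H] [InnerProductSpace ℂ H] [CompleteSpace H] {ψ : ℤ → H}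
  {B : H →L[ℂ] EllTwo}

theorem IsAnalysisOp.isDeterministicSpectrum (hB : IsAnalysisOp ψ B) (hL : IsLaurentOp (gramOp B))
    (P₀ : Measure ℝ) [IsProbabilityMeasure P₀] (hK : IsCompact P₀.support)
    (hpos : P₀.support ⊆ Ioi 0) :
    IsDeterministicSpectrum ψ P₀ (multiplierSpectrum B P₀.support) := by
  filter_upwards [ae_isTypical P₀] with κ hκ
  refine ⟨besselMultiplier B κ, hB.isRandomSum_besselMultiplier
    (hK.isBounded.subset (range_subset_iff.mpr hκ.1)), ?_⟩
  rw [← spectrum_besselMultiplier_eq_of_isTypical hL hK hpos hκ]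
  exact (isSelfAdjoint_besselMultiplier B κ).spectrumRestricts.algebraMap_image.symm

theorem spectrum_gramOp_subset_Ici {ι : Type*} (B : H →L[ℂ] ℓ²(ι, ℂ)) :
    spectrum ℝ (gramOp B) ⊆ Ici 0 := fun _ hy =>
  mem_Ici.mpr (spectrum_nonneg_of_nonneg ((nonneg_iff_isPositive _).mpr (isPositive_gramOp B)) hy)

theorem IsAnalysisOp.exists_pos_mem_spectrum_gramOp (hB : IsAnalysisOp ψ B) {n : ℤ}
    (hn : ψ n ≠ 0) : ∃ y ∈ spectrum ℝ (gramOp B), 0 < y := by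
  by_contra! hle
  have hzero : gramOp B = 0 := by
    have := norm_sub_algebraMap_midpoint_le (isPositive_gramOp B).isSelfAdjoint le_rfl
      fun _ hy => ⟨spectrum_gramOp_subset_Ici B hy, hle _ hy⟩
    simpa using this
  have hGram : gramMatrix ψ n n = 0 := by
    rw [← hB.gramOp_single, hzero]
    rfl
  exact hn (inner_self_eq_zero.mp hGram)

end DeterministicSpectrum

section RealProducts

variable {K R S : Set ℝ}

theorem mul_closedConvexHull_subset_Icc (hK : IsCompact K) (hKpos : K ⊆ Ioi 0) (hR : IsCompact R)
    (hRne : R.Nonempty) (hRpos : R ⊆ Ici 0) :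
    K * closedConvexHull ℝ R ⊆ Icc (sInf K * sInf R) (sSup K * sSup R) := by
  rw [closedConvexHull_eq_Icc hR hRne]
  rintro _ ⟨k, hk, y, hy, rfl⟩
  have hm : 0 ≤ sInf R := hRpos (hR.sInf_mem hRne)
  have hk0 : 0 ≤ k := (hKpos hk).le
  have hkM := le_csSup hK.bddAbove hk
  exact ⟨mul_le_mul (csInf_le hK.bddBelow hk) hy.1 hm hk0,
    mul_le_mul hkM hy.2 (hm.trans hy.1) (hk0.trans hkM)⟩

theorem isGreatest_of_diff_zero_subset (hK : IsCompact K) (hKne : K.Nonempty) (hKpos : K ⊆ Ioi 0)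
    (hR : IsCompact R) (hRne : R.Nonempty) (hRpos : R ⊆ Ici 0) (hM : 0 < sSup R)
    (hlower : (K * R) \ {0} ⊆ S) (hupper : S \ {0} ⊆ K * closedConvexHull ℝ R) :
    IsGreatest S (sSup K * sSup R) := by
  have hmax : 0 < sSup K * sSup R := mul_pos (hKpos (hK.sSup_mem hKne)) hM
  have hmem : sSup K * sSup R ∈ K * R := mul_mem_mul (hK.sSup_mem hKne) (hR.sSup_mem hRne)
  refine ⟨hlower ⟨hmem, hmax.ne'⟩, fun t ht => ?_⟩
  rcases eq_or_ne t 0 with rfl | ht0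
  · exact hmax.le
  · exact (mul_closedConvexHull_subset_Icc hK hKpos hR hRne hRpos (hupper ⟨ht, ht0⟩)).2

theorem mul_subset_of_diff_zero_subset (hKpos : K ⊆ Ioi 0) (h0 : 0 ∈ R → 0 ∈ S)
    (h : (K * R) \ {0} ⊆ S) : K * R ⊆ S := by
  rintro _ ⟨k, hk, y, hy, rfl⟩
  rcases eq_or_ne y 0 with rfl | hy0
  · simpa only [mul_zero] using h0 hy
  · exact h ⟨mul_mem_mul hk hy, mul_ne_zero (hKpos hk).ne' hy0⟩

theorem subset_mul_closedConvexHull_of_diff_zero_subset (hKne : K.Nonempty) (h0 : 0 ∈ S → 0 ∈ R)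
    (h : S \ {0} ⊆ K * closedConvexHull ℝ R) : S ⊆ K * closedConvexHull ℝ R := by
  obtain ⟨k, hk⟩ := hKne
  intro t ht
  rcases eq_or_ne t 0 with rfl | ht0
  · exact ⟨k, hk, 0, subset_closedConvexHull (h0 ht), mul_zero k⟩
  · exact h ⟨ht, ht0⟩

theorem eq_mul_of_ordConnected (hR : IsCompact R) (hRne : R.Nonempty) (hconn : R.OrdConnected)
    (hlower : K * R ⊆ S) (hupper : S ⊆ K * closedConvexHull ℝ R) : S = K * R := by
  rw [closedConvexHull_eq_Icc hR hRne] at hupper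
  exact (hupper.trans (mul_subset_mul_left
    (hconn.out (hR.sInf_mem hRne) (hR.sSup_mem hRne)))).antisymm hlower

end RealProducts

end RandomProjections

end

theorem mainTheorem5 {H : Type*} [NormedAddCommGroup H] [InnerProductSpace ℂ H] [CompleteSpace H]
    (P₀ : Measure ℝ) [IsProbabilityMeasure P₀]
    (hcpt : IsCompact P₀.support) (hpos : P₀.support ⊆ Ioi 0)
    (ψ : ℤ → H) (hnorm : ∀ n, ‖ψ n‖ = 1)
    (hbdd : RandomProjections.IsBoundedMatrix (RandomProjections.gramMatrix ψ))
    (hshift : ∀ n m : ℤ, RandomProjections.gramMatrix ψ (n + 1) (m + 1) =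
      RandomProjections.gramMatrix ψ n m)
    (K R : Set ℝ) (hK : K = P₀.support)
    (hR : R = RandomProjections.essRan (RandomProjections.symbol ψ)) :
    ∃ S : Set ℝ, RandomProjections.IsDeterministicSpectrum ψ P₀ S ∧
      -- away from the point `0`, for every space `H` and every `ψ`
      ((K * R) \ {0} ⊆ S ∧ S \ {0} ⊆ K * closedConvexHull ℝ R ∧
        IsGreatest S (sSup K * sSup R)) ∧
      -- including the point `0`
      (RandomProjections.ZeroCompatible ψ →
        K * R ⊆ S ∧ S ⊆ K * closedConvexHull ℝ R ∧
        S ⊆ Icc (sInf K * sInf R) (sSup K * sSup R) ∧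
        IsLeast S (sInf K * sInf R) ∧ IsGreatest S (sSup K * sSup R) ∧
        (R.OrdConnected → S = K * R)) := by
  open RandomProjections in
  subst hK
  obtain ⟨B, hB⟩ := exists_isAnalysisOp_of_isBoundedMatrix hbdd
  have hL := hB.isLaurentOp_gramOp hshift
  have hspec : spectrum ℝ (gramOp B) = R := (hB.spectrum_gramOp hL).trans hR.symm
  have hKne : P₀.support.Nonempty := Measure.nonempty_support (IsProbabilityMeasure.ne_zero P₀)
  have hRpos : R ⊆ Ici 0 := hspec ▸ spectrum_gramOp_subset_Ici B
  have hRcpt : IsCompact R := hspec ▸ spectrum.isCompact (gramOp B)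
  obtain ⟨y, hyR, hy⟩ : ∃ y ∈ R, 0 < y :=
    hspec ▸ hB.exists_pos_mem_spectrum_gramOp (norm_ne_zero_iff.mp ((hnorm 0).trans_ne one_ne_zero))
  have hRne : R.Nonempty := ⟨y, hyR⟩
  have hlower := hspec ▸ mul_spectrum_gramOp_diff_zero_subset (B := B) hpos
  have hupper : multiplierSpectrum B P₀.support \ {0} ⊆ P₀.support * closedConvexHull ℝ R :=
    hspec ▸ multiplierSpectrum_diff_zero_subset hcpt hpos (hspec ▸ hRne)
  have hgreatest := isGreatest_of_diff_zero_subset hcpt hKne hpos hRcpt hRne hRpos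
    (hy.trans_le (le_csSup hRcpt.bddAbove hyR)) hlower hupper
  refine ⟨_, hB.isDeterministicSpectrum hL P₀ hcpt hpos, ⟨hlower, hupper, hgreatest⟩, fun hZ => ?_⟩
  have hzero := hR ▸ hB.zero_mem_multiplierSpectrum_iff (hspec.trans hR) hcpt hKne hpos hZ
  have hlower' := mul_subset_of_diff_zero_subset hpos hzero.mpr hlower
  have hupper' := subset_mul_closedConvexHull_of_diff_zero_subset hKne hzero.mp hupper
  have hIcc := hupper'.trans (mul_closedConvexHull_subset_Icc hcpt hpos hRcpt hRne hRpos)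
  exact ⟨hlower', hupper', hIcc, ⟨hlower' (mul_mem_mul (hcpt.sInf_mem hKne) (hRcpt.sInf_mem hRne)),
    fun t ht => (hIcc ht).1⟩, hgreatest, (eq_mul_of_ordConnected hRcpt hRne · hlower' hupper')⟩
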